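/- Write $2^{\aleph_0}$ also for the initial ordinal of this cardinality, and for an ordinal $\alpha$ and $k<\omega$ write $\alpha = k \bmod \omega$ if $\alpha=\omega\cdot\beta+k$ for some ordinal $\beta$. A family $\mathcal A\subseteq\mathcal P(\omega)$ is independent if $\bigcap\mathcal F_0\cap\bigcap\{\omega\setminus A : A\in\mathcal F_1\}$ is infinite for all disjoint finite $\mathcal F_0,\mathcal F_1\subseteq\mathcal A$. Let $\bar A=\langle A_{\alpha,n} : \alpha\le 2^{\aleph_0},\ n<\omega\rangle$ be a good independent sequence, that is, a sequence of subsets of $\omega$ such that - $\{A_{\alpha,n} : \alpha\le 2^{\aleph_0}, n<\omega\}$ is an independent family, and $(\alpha,n)\mapsto A_{\alpha,n}$ is injective; - for all $k,m,n<\omega$ and all $u_\ell\subseteq m$ ($\ell<n$) there are $2^{\aleph_0}$ many ordinals $\alpha\le 2^{\aleph_0}$ with $\alpha = k \bmod\omega$ and $A_{\alpha,\ell}\cap m=u_\ell$ for all $\ell<n$; - for all $i<j<\omega$ there is an $n<\omega$ with $|A_{2^{\aleph_0},n}\cap\{i,j\}|=1$. Let $\tau$ be the vocabulary with unary predicates $P,Q$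 and binary predicates $R_n$ ($n<\omega$). Let $N_2$ be the $\tau$-structure with universe $\{b_i : i<\omega\}\cup\{c_\alpha : \alpha\le 2^{\aleph_0}\}$ (without repetition), $Q^{N_2}=\{b_i : i<\omega\}$, $P^{N_2}=\{c_\alpha : \alpha\le 2^{\aleph_0}\}$, and $R_n^{N_2}\subseteq Q^{N_2}\times P^{N_2}$ given as follows: $(b_i,c_{2^{\aleph_0}})\in R_n^{N_2}$ if and only if $i\in A_{2^{\aleph_0},n}$; and if $\alpha<2^{\aleph_0}$ and $\alpha= m\bmod\omega$, then $(b_i,c_\alpha)\in R_n^{N_2}$ if and only if $n\le m$ and $i\in A_{\alpha,n}$. Let $N_1$ be the restriction of $N_2$ to $\{b_i : i<\omega\}\cup\{c_\alpha : \alpha<2^{\aleph_0}\}$. Let $H((2^{\aleph_0})^+)$ be the set of all sets whose transitive closure has cardinality less than $(2^{\aleph_0})^+$, and let $\mathcal X\prec (H((2^{\aleph_0})^+),\in)$ be a countable elementary submodel with $\bar A\in\mathcal X$. Let $M_1$ be the restriction of $N_2$ to $\{b_i : i<\omega\}\cup\{c_\alpha : \alpha\in 2^{\aleph_0}\cap\mathcal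 X\}$, and let $M_2$ be the restriction of $N_2$ to $\{b_i : i<\omega\}\cup\{c_\alpha : \alpha\in (2^{\aleph_0}+1)\cap\mathcal X\}$. Then 1. $N_1\prec N_2$; 2. $M_1\prec M_2$; 3. $M_1\prec_{\infty,\aleph_0}N_1$, that is, $M_1\subseteq N_1$ and every $\mathcal L_{\infty,\aleph_0}$-formula with finitely many free variables has the same truth value in $M_1$ and in $N_1$ at every tuple of elements of $M_1$. In particular, $M_1$ is extendible: it is countable and $\mathcal L_{\infty,\aleph_0}$-elementarily equivalent to an uncountable structure. -/

import Mathlib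

open Set Cardinal

universe u v w u'

namespace Infinitary

/-- Formulas of the infinitary logic `L_{∞,ℵ₀}` whose free variables are among `x₀, …, x_{n-1}`:
conjunctions over arbitrary index types (in the universe `w`), and quantification over one variable
at a time.  Disjunctions and existential quantifiers are the usual abbreviations. -/
inductive InfFormula (L : FirstOrder.Language.{u, v}) : ℕ → Type (max u v (w + 1))
  | equal {n : ℕ} (s t : L.Term (Fin n)) : InfFormula L n
  | rel {n l : ℕ} (R : L.Relations l)
      (ts : Fin l → L.Term (Fin n)) : InfFormula L n
  | neg {n : ℕ} (φ : InfFormula L n) : InfFormula L n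
  | conj {n : ℕ} {ι : Type w} (φ : ι → InfFormula L n) : InfFormula L n
  | all {n : ℕ} (φ : InfFormula L (n + 1)) : InfFormula L n

/-- Tarskian satisfaction of an `L_{∞,ℵ₀}`-formula. -/
def InfFormula.Realize {L : FirstOrder.Language.{u, v}} {M : Type u'} [L.Structure M] :
    {n : ℕ} → InfFormula.{u, v, w} L n → (Fin n → M) → Prop
  | _, .equal s t, x => s.realize x = t.realize x
  | _, .rel R ts, x => FirstOrder.Language.Structure.RelMap R fun i => (ts i).realize x
  | _, .neg φ, x => ¬ φ.Realize x
  | _, .conj φ, x => ∀ i, (φ i).Realize x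
  | _, .all φ, x => ∀ a : M, φ.Realize (Fin.snoc x a)

/-- `M ≡_{∞,ℵ₀} N`: the two structures satisfy the same `L_{∞,ℵ₀}`-sentences. -/
def InfEquiv (L : FirstOrder.Language.{u, v}) (M N : Type u') [L.Structure M] [L.Structure N] : Prop :=
  ∀ φ : InfFormula.{u, v, w} L 0,
    φ.Realize (Fin.elim0 : Fin 0 → M) ↔ φ.Realize (Fin.elim0 : Fin 0 → N)

/-- A countable structure is extendible if it is `L_{∞,ℵ₀}`-elementarily equivalent to some
uncountable structure. -/
def Extendible (L : FirstOrder.Language.{u, v}) (M : Type u') [L.Structure M] : Prop :=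
  Countable M ∧ ∃ (N : Type u') (_ : L.Structure N), Uncountable N ∧ InfEquiv.{u, v, w} L M N

/-- `S ≺ T` for two substructures of a common structure: `S ⊆ T`, and first-order formulas have the
same truth values in `S` and in `T` at tuples of elements of `S`. -/
def ElemSub {L : FirstOrder.Language.{u, v}} {M : Type u'} [L.Structure M] (S T : L.Substructure M) : Prop :=
  ∃ h : S ≤ T, ∀ (n : ℕ) (φ : L.Formula (Fin n)) (x : Fin n → S),
    φ.Realize (fun i => FirstOrder.Language.Substructure.inclusion h (x i)) ↔ φ.Realize x

/-- `S ≺_{∞,ℵ₀} T` for two substructures of a common structure: `S ⊆ T`, and `L_{∞,ℵ₀}`-formulas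
have the same truth values in `S` and in `T` at (finite) tuples of elements of `S`. -/
def InfElemSub {L : FirstOrder.Language.{u, v}} {M : Type u'} [L.Structure M]
    (S T : L.Substructure M) : Prop :=
  ∃ h : S ≤ T, ∀ (n : ℕ) (φ : InfFormula.{u, v, w} L n) (x : Fin n → S),
    φ.Realize (fun i => FirstOrder.Language.Substructure.inclusion h (x i)) ↔ φ.Realize x

end Infinitary

namespace LarsonShelah

/-! ### Good independent sequences -/

/-- The cardinal `2^ℵ₀` as an (initial) ordinal. -/
noncomputable def cont : Ordinal.{0} := (continuum : Cardinal.{0}).ord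

/-- The index set of the ordinals `α ≤ 2^ℵ₀`. -/
abbrev Idx : Type 1 := Set.Iic cont

/-- The index `2^ℵ₀`. -/
noncomputable def topIdx : Idx := ⟨cont, Set.mem_Iic.2 le_rfl⟩

/-- Families `⟨A_{α,n} : α ≤ 2^ℵ₀, n < ω⟩` of sets of natural numbers. -/
abbrev SetSeq : Type 1 := Idx → ℕ → Set ℕ

/-- Independent families of subsets of `ω`. -/
def IndependentFamily (𝒜 : Set (Set ℕ)) : Prop :=
  ∀ F₀ F₁ : Finset (Set ℕ), (F₀ : Set (Set ℕ)) ⊆ 𝒜 → (F₁ : Set (Set ℕ)) ⊆ 𝒜 → Disjoint F₀ F₁ →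
    ((⋂ B ∈ F₀, B) ∩ ⋂ B ∈ F₁, Bᶜ).Infinite

/-- Good independent sequences.  For an ordinal `α` and `k < ω`, the congruence `α = k mod ω` says
that `α = ω * β + k` for some `β`, that is, `α % ω = k`. -/
structure IsGood (A : SetSeq) : Prop where
  independent : IndependentFamily {B | ∃ α n, B = A α n}
  injective : ∀ α β m n, A α m = A β n → α = β ∧ m = n
  generic : ∀ (k m n : ℕ) (s : Fin n → Set ℕ), (∀ l, s l ⊆ Set.Iio m) →
    #{α : Idx | (α : Ordinal) % Ordinal.omega0 = k ∧
      ∀ l : Fin n, A α l ∩ Set.Iio m = s l} = continuum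
  separating : ∀ i j : ℕ, i < j → ∃ n, (A topIdx n ∩ {i, j}).ncard = 1

/-! ### The vocabulary and the structures -/

/-- The relation symbols: unary `P`, `Q` and binary `R n` for every natural number `n`. -/
inductive TauRel : ℕ → Type
  | P : TauRel 1
  | Q : TauRel 1
  | R (n : ℕ) : TauRel 2

/-- The relational vocabulary `τ = {P, Q, Rₙ : n < ω}`. -/
def tau : FirstOrder.Language.{0, 0} := ⟨fun _ => Empty, TauRel⟩

/-- The underlying set of `N₂`: elements `b i` for `i < ω` and `c α` for `α ≤ 2^ℵ₀`, without
repetition. -/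
inductive N₂ (A : SetSeq) : Type 1
  | b (i : ℕ) : N₂ A
  | c (α : Idx) : N₂ A

/-- `Rₙ(x, y)` in `N₂`. -/
def N₂.relR {A : SetSeq} (n : ℕ) : N₂ A → N₂ A → Prop
  | .b i, .c α =>
      (α = topIdx ∧ i ∈ A α n) ∨
      ((α : Ordinal) < cont ∧ ∃ m : ℕ, (α : Ordinal) % Ordinal.omega0 = m ∧ n ≤ m ∧ i ∈ A α n)
  | _, _ => False

/-- The `τ`-structure on `N₂`. -/
instance N₂.struc (A : SetSeq) : tau.Structure (N₂ A) where
  funMap f := Empty.elim f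
  RelMap r x :=
    match r with
    | TauRel.P => ∃ α, x 0 = N₂.c α
    | TauRel.Q => ∃ i, x 0 = N₂.b i
    | TauRel.R n => N₂.relR n (x 0) (x 1)

/-- The restriction of `N₂` to `{b i : i < ω} ∪ {c α : α ∈ Z}`, for a set `Z` of ordinals. -/
def restr (A : SetSeq) (Z : Set Ordinal.{0}) : tau.Substructure (N₂ A) where
  carrier := {x | (∃ i, x = N₂.b i) ∨ ∃ α : Idx, (α : Ordinal) ∈ Z ∧ x = N₂.c α}
  fun_mem f := Empty.elim f

/-- `N₁`, the restriction of `N₂` to the `b i` and the `c α` with `α < 2^ℵ₀`. -/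
noncomputable def N₁ (A : SetSeq) : tau.Substructure (N₂ A) := restr A (Set.Iio cont)

/-! ### The structure `(H(κ), ∈)` -/

/-- `H(κ)`, the sets whose transitive closure has fewer than `κ` elements; equivalently, those that
are included in a transitive set with fewer than `κ` elements. -/
def H (κ : Cardinal.{0}) : Type 1 :=
  {x : ZFSet.{0} // ∃ t : ZFSet.{0}, t.IsTransitive ∧ x ⊆ t ∧ t.card < κ}

/-- The only symbol of the language of set theory. -/
inductive SetRel : ℕ → Type
  | mem : SetRel 2

/-- The language of set theory. -/
def setLang : FirstOrder.Language.{0, 0} := ⟨fun _ => Empty, SetRel⟩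

/-- `(H(κ), ∈)`. -/
instance H.struc (κ : Cardinal.{0}) : setLang.Structure (H κ) where
  funMap f := Empty.elim f
  RelMap r x :=
    match r with
    | SetRel.mem => (x 0).val ∈ (x 1).val

/-- A set of natural numbers as a set of von Neumann natural numbers. -/
noncomputable def codeSet (B : Set ℕ) : ZFSet.{0} :=
  ZFSet.range fun i : B => ((i : ℕ) : Ordinal.{0}).toZFSet

/-- The sequence `⟨A_{α,n}⟩` as an object of set theory: the function, as a set of ordered pairs,
that sends `(α, n)` to `A_{α,n}`. -/
noncomputable def codeSeq (A : SetSeq) : ZFSet.{0} :=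
  ZFSet.range fun p : Idx × ℕ =>
    ZFSet.pair (ZFSet.pair (p.1 : Ordinal.{0}).toZFSet (p.2 : Ordinal.{0}).toZFSet)
      (codeSet (A p.1 p.2))

/-- The elementary submodels `𝒳 ≺ (H((2^ℵ₀)⁺), ∈)`. -/
abbrev Submodel : Type 1 := setLang.ElementarySubstructure (H (Order.succ continuum))

/-- The set `x` is an element of `𝒳`. -/
def Submodel.Has (X : Submodel) (x : ZFSet.{0}) : Prop := ∃ y ∈ X, y.val = x

/-- The ordinals that are elements of `𝒳`. -/
def Submodel.ordinals (X : Submodel) : Set Ordinal.{0} := {α | X.Has α.toZFSet}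

/-- `M₁`, the restriction of `N₂` to the `b i` and the `c α` with `α ∈ 2^ℵ₀ ∩ 𝒳`. -/
noncomputable def M₁ (A : SetSeq) (X : Submodel) : tau.Substructure (N₂ A) :=
  restr A (Set.Iio cont ∩ Submodel.ordinals X)

/-- `M₂`, the restriction of `N₂` to the `b i` and the `c α` with `α ∈ (2^ℵ₀ + 1) ∩ 𝒳`. -/
noncomputable def M₂ (A : SetSeq) (X : Submodel) : tau.Substructure (N₂ A) :=
  restr A (Set.Iio (cont + 1) ∩ Submodel.ordinals X)

end LarsonShelah

/-!
All three relations come from back-and-forth systems of finite partial isomorphisms. With respect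
to `Rₙ` for `n ≤ K`, an element `c α` is governed by its depth truncated at `K` (the depth being
the `k` with `α = k mod ω`, or `⊤` for `α = 2^ℵ₀`): only the relations up to that bound constrain
the images of the `b i`. If the bound is finite, independence supplies the image of a new `b i`,
and that of a new `c α` exists as soon as the target has infinitely many indices of each residue
and each finite membership pattern, which genericity ensures for `N₁`. Below `2^ℵ₀` all depths are
finite, so `K = ⊤` is allowed and the system preserves `L_{∞,ℵ₀}`-formulas. With `2^ℵ₀` present,
`K` must be finite: `c_{2^ℵ₀}` then looks like some `c α` of depth `K`, which is enough for a
first-order formula, since only finitely many `Rₙ` occur in it. For `M₁`, the indices of a given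
residue and pattern form a set definable from `Ā` in `(H(κ), ∈)`, and an elementary submodel
contains infinitely many elements of every infinite set definable over it.
-/

namespace Infinitary

section BackAndForth

variable {L : FirstOrder.Language.{u, v}} {M N : Type*} [L.Structure M] [L.Structure N]

/-- A back-and-forth system between `M` and `N` for the relation symbols in `Λ` (and all function
symbols), given as a relation between tuples of the same length. Restricting the symbols to `Λ`
makes room for first-order formulas, which mention finitely many of them. -/
structure BackAndForth (Λ : Set (Σ l, L.Relations l))
    (r : ∀ ⦃n : ℕ⦄, (Fin n → M) → (Fin n → N) → Prop) : Prop where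
  realize_eq_iff : ∀ {n : ℕ} {x : Fin n → M} {y : Fin n → N}, r x y →
    ∀ s t : L.Term (Fin n), s.realize x = t.realize x ↔ s.realize y = t.realize y
  relMap_iff : ∀ {n : ℕ} {x : Fin n → M} {y : Fin n → N}, r x y →
    ∀ {l : ℕ} (R : L.Relations l), ⟨l, R⟩ ∈ Λ → ∀ ts : Fin l → L.Term (Fin n),
      FirstOrder.Language.Structure.RelMap R (fun i => (ts i).realize x) ↔
        FirstOrder.Language.Structure.RelMap R (fun i => (ts i).realize y)
  forth : ∀ {n : ℕ} {x : Fin n → M} {y : Fin n → N}, r x y →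
    ∀ a, ∃ b, r (Fin.snoc x a : Fin (n + 1) → M) (Fin.snoc y b : Fin (n + 1) → N)
  back : ∀ {n : ℕ} {x : Fin n → M} {y : Fin n → N}, r x y →
    ∀ b, ∃ a, r (Fin.snoc x a : Fin (n + 1) → M) (Fin.snoc y b : Fin (n + 1) → N)

namespace BackAndForth

variable {Λ Λ' : Set (Σ l, L.Relations l)} {r : ∀ ⦃n : ℕ⦄, (Fin n → M) → (Fin n → N) → Prop}

theorem mono (h : BackAndForth Λ' r) (hΛ : Λ ⊆ Λ') : BackAndForth Λ r where
  realize_eq_iff := h.realize_eq_iff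
  relMap_iff hxy _ R hR := h.relMap_iff hxy R (hΛ hR)
  forth := h.forth
  back := h.back

theorem forall_snoc_iff (h : BackAndForth Λ r) {n : ℕ} {x : Fin n → M} {y : Fin n → N}
    (hxy : r x y) {p : (Fin (n + 1) → M) → Prop} {q : (Fin (n + 1) → N) → Prop}
    (hpq : ∀ {x y}, r x y → (p x ↔ q y)) :
    (∀ a, p (Fin.snoc x a)) ↔ ∀ b, q (Fin.snoc y b) := by
  constructor
  · intro hp b
    obtain ⟨a, hab⟩ := h.back hxy b
    exact (hpq hab).1 (hp a)
  · intro hq a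
    obtain ⟨b, hab⟩ := h.forth hxy a
    exact (hpq hab).2 (hq b)

theorem realize_infFormula_iff (h : BackAndForth (L := L) Set.univ r) {n : ℕ}
    (φ : InfFormula.{u, v, w} L n) {x : Fin n → M} {y : Fin n → N} (hxy : r x y) :
    φ.Realize x ↔ φ.Realize y := by
  induction φ with
  | equal s t => exact h.realize_eq_iff hxy s t
  | rel R ts => exact h.relMap_iff hxy R (Set.mem_univ _) ts
  | neg φ ih => exact not_congr (ih hxy)
  | conj φ ih => exact forall_congr' fun i => ih i hxy
  | all φ ih => exact h.forall_snoc_iff hxy ih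

end BackAndForth

theorem realize_sumElim_empty {n : ℕ} (t : L.Term (Empty ⊕ Fin n)) (v : Empty → M)
    (x : Fin n → M) :
    t.realize (Sum.elim v x) = (t.relabel (Sum.elim Empty.elim id)).realize x := by
  rw [FirstOrder.Language.Term.realize_relabel]
  congr 1
  ext (i | i)
  exacts [i.elim, rfl]

theorem exists_finite_realize_boundedFormula_iff {n : ℕ} (φ : L.BoundedFormula Empty n) :
    ∃ Λ : Set (Σ l, L.Relations l), Λ.Finite ∧
      ∀ {r : ∀ ⦃n : ℕ⦄, (Fin n → M) → (Fin n → N) → Prop}, BackAndForth Λ r →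
        ∀ {x : Fin n → M} {y : Fin n → N}, r x y →
          (φ.Realize default x ↔ φ.Realize default y) := by
  induction φ with
  | falsum => exact ⟨∅, Set.finite_empty, fun _ _ _ _ => Iff.rfl⟩
  | equal s t =>
    refine ⟨∅, Set.finite_empty, fun h _ _ hxy => ?_⟩
    simp only [FirstOrder.Language.BoundedFormula.Realize, realize_sumElim_empty]
    exact h.realize_eq_iff hxy _ _
  | rel R ts =>
    refine ⟨{⟨_, R⟩}, Set.finite_singleton _, fun h _ _ hxy => ?_⟩
    simp only [FirstOrder.Language.BoundedFormula.Realize, realize_sumElim_empty]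
    exact h.relMap_iff hxy R rfl _
  | imp φ ψ ihφ ihψ =>
    obtain ⟨Λ, hΛ, hφ⟩ := ihφ
    obtain ⟨Λ', hΛ', hψ⟩ := ihψ
    exact ⟨Λ ∪ Λ', hΛ.union hΛ', fun h _ _ hxy => imp_congr
      (hφ (h.mono Set.subset_union_left) hxy) (hψ (h.mono Set.subset_union_right) hxy)⟩
  | all φ ih =>
    obtain ⟨Λ, hΛ, hφ⟩ := ih
    exact ⟨Λ, hΛ, fun h _ _ hxy => h.forall_snoc_iff hxy (hφ h)⟩

end BackAndForth

section Substructures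

variable {L : FirstOrder.Language.{u, v}} {M : Type u'} [L.Structure M] {S T : L.Substructure M}

theorem InfElemSub.of_backAndForth (hST : S ≤ T)
    {r : ∀ ⦃n : ℕ⦄, (Fin n → T) → (Fin n → S) → Prop} (h : BackAndForth (L := L) Set.univ r)
    (hr : ∀ {n : ℕ} (x : Fin n → S), r (FirstOrder.Language.Substructure.inclusion hST ∘ x) x) :
    InfElemSub.{u, v, w} S T :=
  ⟨hST, fun _ φ x => h.realize_infFormula_iff φ (hr x)⟩

theorem ElemSub.of_backAndForth (hST : S ≤ T)
    (h : ∀ Λ : Set (Σ l, L.Relations l), Λ.Finite →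
      ∃ r : ∀ ⦃n : ℕ⦄, (Fin n → T) → (Fin n → S) → Prop, BackAndForth Λ r ∧
        ∀ {n : ℕ} (x : Fin n → S), r (FirstOrder.Language.Substructure.inclusion hST ∘ x) x) :
    ElemSub S T := by
  refine ⟨hST, fun n φ x => ?_⟩
  obtain ⟨Λ, hΛ, hφ⟩ := exists_finite_realize_boundedFormula_iff (M := T) (N := S)
    (FirstOrder.Language.BoundedFormula.relabel (Sum.inr : Fin n → Empty ⊕ Fin n) φ)
  obtain ⟨r, hr, hrx⟩ := h Λ hΛ
  have := hφ hr (hrx x)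
  rwa [FirstOrder.Language.Formula.realize_relabel_sumInr,
    FirstOrder.Language.Formula.realize_relabel_sumInr] at this

theorem ElemSub.isElementary (h : ElemSub S ⊤) : S.IsElementary := by
  obtain ⟨hST, h⟩ := h
  intro n φ x
  rw [← h n φ x,
    ← FirstOrder.Language.StrongHomClass.realize_formula FirstOrder.Language.Substructure.topEquiv]
  rfl

theorem InfElemSub.infEquiv (h : InfElemSub.{u, v, w} S T) : InfEquiv.{u, v, w} L S T := by
  obtain ⟨_, h⟩ := h
  intro φ
  rw [← h 0 φ Fin.elim0]
  exact iff_of_eq (congrArg _ (Subsingleton.elim _ _))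

end Substructures

end Infinitary

namespace LarsonShelah

variable {A : SetSeq}

section Patterns

/-- An indexed family of sets of natural numbers is independent if every finite membership pattern
is realized infinitely often. -/
def IsIndependent {ι : Type*} (B : ι → Set ℕ) : Prop :=
  ∀ T : Set ι, T.Finite → ∀ p : ι → Prop, {i | ∀ t ∈ T, i ∈ B t ↔ p t}.Infinite

theorem IndependentFamily.isIndependent {ι : Type*} {B : ι → Set ℕ}
    (hB : IndependentFamily (Set.range B)) (hinj : Function.Injective B) : IsIndependent B := by
  classical
  intro T hT p
  lift T to Finset ι using hT
  have hrange (q : ι → Prop) [DecidablePred q] :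
      (((T.filter q).image B : Finset (Set ℕ)) : Set (Set ℕ)) ⊆ Set.range B := by
    rw [Finset.coe_image]
    exact Set.image_subset_range _ _
  have hdisj : Disjoint ((T.filter p).image B) ((T.filter fun t => ¬ p t).image B) :=
    (Finset.disjoint_image hinj).2 (Finset.disjoint_filter_filter_not _ _ _)
  refine (hB _ _ (hrange p) (hrange fun t => ¬ p t) hdisj).mono fun i hi t ht => ?_
  simp only [Finset.mem_image, Finset.mem_filter, Set.mem_inter_iff, Set.mem_iInter,
    Set.mem_compl_iff] at hi
  exact ⟨fun hit => by_contra fun hp => hi.2 _ ⟨t, ⟨ht, hp⟩, rfl⟩ hit,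
    fun hp => hi.1 _ ⟨t, ⟨ht, hp⟩, rfl⟩⟩

theorem IsGood.isIndependent (hA : IsGood A) : IsIndependent fun t : Idx × ℕ => A t.1 t.2 := by
  refine IndependentFamily.isIndependent ?_ fun s t h =>
    Prod.ext (hA.injective _ _ _ _ h).1 (hA.injective _ _ _ _ h).2
  convert hA.independent using 1
  ext B
  simp only [Set.mem_range, Prod.exists, Set.mem_ofPred_eq, eq_comm]

/-- A set `Z` of ordinals is rich for `A` if for every `k`, every finite pattern of memberships
`d.2 ∈ A α d.1` is realized by infinitely many `α ∈ Z` with `α = k mod ω`. -/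
def IsRich (A : SetSeq) (Z : Set Ordinal.{0}) : Prop :=
  ∀ (k : ℕ) (D : Set (ℕ × ℕ)), D.Finite → ∀ p : ℕ × ℕ → Prop,
    {α : Idx | (α : Ordinal) ∈ Z ∧ (α : Ordinal) % Ordinal.omega0 = k ∧
      ∀ d ∈ D, d.2 ∈ A α d.1 ↔ p d}.Infinite

theorem IsRich.mono {Z Z' : Set Ordinal.{0}} (h : IsRich A Z) (hZ : Z ⊆ Z') : IsRich A Z' :=
  fun k D hD p => (h k D hD p).mono fun _ hα => ⟨hZ hα.1, hα.2⟩

theorem coe_lt_cont {α : Idx} (h : α ≠ topIdx) : (α : Ordinal) < cont :=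
  lt_of_le_of_ne α.2 fun h' => h (Subtype.ext h')

theorem IsRich.Iio_cont_inter {Z : Set Ordinal.{0}} (h : IsRich A Z) :
    IsRich A (Set.Iio cont ∩ Z) := fun k D hD p =>
  ((h k D hD p).sdiff (Set.finite_singleton topIdx)).mono fun _ hα =>
    ⟨⟨coe_lt_cont hα.2, hα.1.1⟩, hα.1.2⟩

theorem IsGood.isRich (hA : IsGood A) : IsRich A Set.univ := by
  intro k D hD p
  obtain ⟨m, hm⟩ := (hD.image Prod.snd).bddAbove
  obtain ⟨n, hn⟩ := (hD.image Prod.fst).bddAbove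
  let s (l : Fin (n + 1)) : Set ℕ := {i | p (l, i)} ∩ Set.Iio (m + 1)
  have hinf : {α : Idx | (α : Ordinal) % Ordinal.omega0 = k ∧
      ∀ l : Fin (n + 1), A α l ∩ Set.Iio (m + 1) = s l}.Infinite := by
    rw [← Set.infinite_coe_iff, Cardinal.infinite_iff,
      hA.generic k (m + 1) (n + 1) s fun _ => Set.inter_subset_right]
    exact aleph0_le_continuum
  refine hinf.mono fun α hα => ⟨Set.mem_univ _, hα.1, fun d hd => ?_⟩
  have hd₁ : d.1 < n + 1 := Nat.lt_succ_of_le (hn ⟨d, hd, rfl⟩)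
  have hd₂ : d.2 < m + 1 := Nat.lt_succ_of_le (hm ⟨d, hd, rfl⟩)
  have := Set.ext_iff.1 (hα.2 ⟨d.1, hd₁⟩) d.2
  simpa only [s, Set.mem_inter_iff, Set.mem_Iio, hd₂, and_true, Set.mem_ofPred_eq] using this

end Patterns

section Depth

/-- The depth of an index `α` is the last `n` for which `Rₙ` may hold at `c α`: it is `⊤` for
`α = 2^ℵ₀`, and otherwise the `k` with `α = k mod ω`. -/
noncomputable def depth (α : Idx) : ℕ∞ :=
  open Classical in
  if α = topIdx then ⊤ else (Cardinal.toNat ((α : Ordinal) % Ordinal.omega0).card : ℕ∞)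

theorem depth_topIdx : depth topIdx = ⊤ :=
  if_pos rfl

theorem depth_eq {α : Idx} (hα : α ≠ topIdx) {k : ℕ} (hk : (α : Ordinal) % Ordinal.omega0 = k) :
    depth α = k := by
  rw [depth, if_neg hα, hk, Ordinal.card_nat, Cardinal.toNat_natCast]

theorem exists_mod_omega0_eq (α : Ordinal.{0}) : ∃ k : ℕ, α % Ordinal.omega0 = k :=
  Ordinal.lt_omega0.1 (Ordinal.mod_lt _ Ordinal.omega0_ne_zero)

theorem depth_ne_top {α : Idx} (hα : α ≠ topIdx) : depth α ≠ ⊤ := by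
  obtain ⟨k, hk⟩ := exists_mod_omega0_eq α
  rw [depth_eq hα hk]
  exact ENat.natCast_ne_top k

theorem relR_b_c {n i : ℕ} {α : Idx} :
    N₂.relR n (.b i : N₂ A) (.c α) ↔ (n : ℕ∞) ≤ depth α ∧ i ∈ A α n := by
  by_cases hα : α = topIdx
  · subst hα
    simp only [N₂.relR, depth_topIdx, le_top, true_and]
    exact or_iff_left fun h => lt_irrefl _ h.1
  · obtain ⟨k, hk⟩ := exists_mod_omega0_eq α
    simp only [N₂.relR, depth_eq hα hk, hα, false_and, false_or, coe_lt_cont hα, true_and, hk,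
      Nat.cast_inj, exists_eq_left', Nat.cast_le]

@[simp] theorem not_relR_b {n i : ℕ} {x : N₂ A} : ¬ N₂.relR n x (.b i) := by
  cases x <;> exact id

@[simp] theorem not_relR_c {n : ℕ} {α : Idx} {x : N₂ A} : ¬ N₂.relR n (.c α) x :=
  id

@[simp] theorem not_relR_self {n : ℕ} {x : N₂ A} : ¬ N₂.relR n x x := by
  cases x
  exacts [not_relR_b, not_relR_c]

/-- The sort of an element of `N₂`, together with its depth truncated at `K` if it is some `c α`:
what the symbols `P`, `Q` and `Rₙ` with `n ≤ K` see of the element by itself. -/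
noncomputable def colour (K : ℕ∞) : N₂ A → Option ℕ∞
  | .b _ => none
  | .c α => some (min K (depth α))

@[simp] theorem colour_b {K : ℕ∞} {i : ℕ} : colour K (.b i : N₂ A) = none :=
  rfl

@[simp] theorem colour_c {K : ℕ∞} {α : Idx} :
    colour K (.c α : N₂ A) = some (min K (depth α)) :=
  rfl

theorem natCast_le_depth_iff {K : ℕ∞} {α β : Idx} {n : ℕ} (hn : (n : ℕ∞) ≤ K)
    (h : min K (depth α) = min K (depth β)) : (n : ℕ∞) ≤ depth α ↔ (n : ℕ∞) ≤ depth β := by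
  have : (n : ℕ∞) ≤ min K (depth α) ↔ (n : ℕ∞) ≤ min K (depth β) := by rw [h]
  simpa only [le_min_iff, hn, true_and] using this

theorem relR_b_c_congr {K : ℕ∞} {i j n : ℕ} {α β : Idx} (hn : (n : ℕ∞) ≤ K)
    (h : min K (depth α) = min K (depth β))
    (hij : (n : ℕ∞) ≤ depth β → (j ∈ A β n ↔ N₂.relR n (.b i : N₂ A) (.c α))) :
    N₂.relR n (.b i : N₂ A) (.c α) ↔ N₂.relR n (.b j : N₂ A) (.c β) := by
  by_cases hnβ : (n : ℕ∞) ≤ depth β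
  · rw [relR_b_c (i := j), hij hnβ, and_iff_right hnβ]
  · rw [relR_b_c, relR_b_c, natCast_le_depth_iff hn h]
    simp only [hnβ, false_and]

/-- All depths of indices in `Z`, truncated at `K`, are finite. -/
def HasFiniteDepth (K : ℕ∞) (Z : Set Ordinal.{0}) : Prop :=
  ∀ α : Idx, (α : Ordinal) ∈ Z → min K (depth α) ≠ ⊤

theorem hasFiniteDepth_natCast (K : ℕ) (Z : Set Ordinal.{0}) : HasFiniteDepth K Z :=
  fun _ _ h => ENat.natCast_ne_top K (min_eq_top.1 h).1

theorem hasFiniteDepth_of_subset_Iio (K : ℕ∞) {Z : Set Ordinal.{0}} (hZ : Z ⊆ Set.Iio cont) :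
    HasFiniteDepth K Z := fun _ hα h =>
  depth_ne_top (fun hα' => (hZ hα).ne (congrArg Subtype.val hα')) (min_eq_top.1 h).2

end Depth

section Restr

theorem c_mem_restr {Z : Set Ordinal.{0}} {α : Idx} :
    (.c α : N₂ A) ∈ restr A Z ↔ (α : Ordinal) ∈ Z := by
  change ((∃ i, N₂.c α = N₂.b i) ∨ ∃ β : Idx, (β : Ordinal) ∈ Z ∧ N₂.c α = N₂.c β) ↔ _
  simp

theorem b_mem_restr {Z : Set Ordinal.{0}} {i : ℕ} : (.b i : N₂ A) ∈ restr A Z :=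
  Or.inl ⟨i, rfl⟩

theorem restr_mono {Z Z' : Set Ordinal.{0}} (h : Z ⊆ Z') : restr A Z ≤ restr A Z' := by
  rintro _ (⟨i, rfl⟩ | ⟨α, hα, rfl⟩)
  exacts [b_mem_restr, c_mem_restr.2 (h hα)]

theorem restr_univ : restr A Set.univ = ⊤ := by
  refine top_unique fun x _ => ?_
  cases x
  exacts [b_mem_restr, c_mem_restr.2 (Set.mem_univ _)]

end Restr

section PartialIso

/-- Two tuples correspond under a partial isomorphism of `N₂` with respect to `P`, `Q` and the `Rₙ`
with `n ≤ K` that also preserves the depths truncated at `K`. -/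
structure PartialIso (K : ℕ∞) {ι : Type*} (x y : ι → N₂ A) : Prop where
  colour_eq : ∀ i, colour K (x i) = colour K (y i)
  eq_iff : ∀ i j, x i = x j ↔ y i = y j
  rel_iff : ∀ n : ℕ, (n : ℕ∞) ≤ K → ∀ i j, N₂.relR n (x i) (x j) ↔ N₂.relR n (y i) (y j)

namespace PartialIso

variable {K : ℕ∞} {m : ℕ} {x y : Fin m → N₂ A}

theorem refl (K : ℕ∞) {ι : Type*} (x : ι → N₂ A) : PartialIso K x x :=
  ⟨fun _ => rfl, fun _ _ => Iff.rfl, fun _ _ _ _ => Iff.rfl⟩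

theorem symm {ι : Type*} {x y : ι → N₂ A} (h : PartialIso K x y) : PartialIso K y x :=
  ⟨fun i => (h.colour_eq i).symm, fun i j => (h.eq_iff i j).symm,
    fun n hn i j => (h.rel_iff n hn i j).symm⟩

theorem comp {ι ι' : Type*} {x y : ι → N₂ A} (h : PartialIso K x y) (f : ι' → ι) :
    PartialIso K (x ∘ f) (y ∘ f) :=
  ⟨fun i => h.colour_eq (f i), fun i j => h.eq_iff (f i) (f j),
    fun n hn i j => h.rel_iff n hn (f i) (f j)⟩

theorem snoc (h : PartialIso K x y) {a b : N₂ A} (hab : colour K a = colour K b)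
    (ha : ∀ i, x i ≠ a) (hb : ∀ i, y i ≠ b)
    (hrel : ∀ n : ℕ, (n : ℕ∞) ≤ K → ∀ i,
      (N₂.relR n (x i) a ↔ N₂.relR n (y i) b) ∧ (N₂.relR n a (x i) ↔ N₂.relR n b (y i))) :
    PartialIso K (Fin.snoc x a : Fin (m + 1) → N₂ A) (Fin.snoc y b : Fin (m + 1) → N₂ A) where
  colour_eq i := by
    induction i using Fin.lastCases with
    | last => simpa only [Fin.snoc_last] using hab
    | cast i => simpa only [Fin.snoc_castSucc] using h.colour_eq i
  eq_iff i j := by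
    induction i using Fin.lastCases <;> induction j using Fin.lastCases <;>
      simp only [Fin.snoc_last, Fin.snoc_castSucc, ha, hb, (ha _).symm, (hb _).symm, h.eq_iff]
  rel_iff n hn i j := by
    induction i using Fin.lastCases <;> induction j using Fin.lastCases <;>
      simp only [Fin.snoc_last, Fin.snoc_castSucc, not_relR_self, h.rel_iff n hn, hrel n hn]

theorem exists_b_eq (h : PartialIso K x y) {i : Fin m} {j : ℕ} (hj : y i = .b j) :
    ∃ l, x i = .b l := by
  have := h.colour_eq i
  cases hx : x i with
  | b l => exact ⟨l, rfl⟩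
  | c α => simp [hx, hj] at this

theorem exists_c_eq (h : PartialIso K x y) {i : Fin m} {β : Idx} (hβ : y i = .c β) :
    ∃ α, x i = .c α ∧ min K (depth α) = min K (depth β) := by
  have := h.colour_eq i
  cases hx : x i with
  | b l => simp [hx, hβ] at this
  | c α => exact ⟨α, rfl, by simpa [hx, hβ] using this⟩

theorem finite_relevant (K : ℕ∞) (y : Fin m → N₂ A) {Z : Set Ordinal.{0}}
    (hZ : HasFiniteDepth K Z) (hy : ∀ i, y i ∈ restr A Z) :
    {t : Idx × ℕ | (∃ i, y i = .c t.1) ∧ (t.2 : ℕ∞) ≤ min K (depth t.1)}.Finite := by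
  have hc : {β : Idx | ∃ i, y i = .c β}.Finite :=
    (Set.finite_range y).preimage (f := N₂.c) fun _ _ _ _ h => N₂.c.inj h
  refine (hc.biUnion (t := fun β => {t | t.1 = β ∧ (t.2 : ℕ∞) ≤ min K (depth β)})
    fun β hβ => ?_).subset fun t ht => Set.mem_biUnion ht.1 ⟨rfl, ht.2⟩
  obtain ⟨i, hi⟩ := hβ
  obtain ⟨N, hN⟩ := ENat.ne_top_iff_exists.1 (hZ β (c_mem_restr.1 (hi ▸ hy i)))
  refine ((Set.finite_singleton β).prod (Set.finite_Iic N)).subset fun t ht => ⟨ht.1, ?_⟩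
  exact Nat.cast_le.1 (hN ▸ ht.2)

theorem exists_snoc_b (hA : IsIndependent fun t : Idx × ℕ => A t.1 t.2) {Z : Set Ordinal.{0}}
    (hZ : HasFiniteDepth K Z) (hy : ∀ i, y i ∈ restr A Z) (h : PartialIso K x y) {l : ℕ}
    (hl : ∀ i, x i ≠ .b l) :
    ∃ j : ℕ, PartialIso K (Fin.snoc x (.b l) : Fin (m + 1) → N₂ A)
      (Fin.snoc y (.b j) : Fin (m + 1) → N₂ A) := by
  have hb : {j : ℕ | ∃ i, y i = .b j}.Finite :=
    (Set.finite_range y).preimage (f := N₂.b) fun _ _ _ _ h => N₂.b.inj h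
  obtain ⟨j, hj, hjy⟩ := ((hA _ (finite_relevant K y hZ hy)
    fun t => ∃ i, y i = .c t.1 ∧ N₂.relR t.2 (.b l) (x i)).sdiff hb).nonempty
  refine ⟨j, h.snoc rfl hl (fun i hi => hjy ⟨i, hi⟩) fun n hn i =>
    ⟨iff_of_false not_relR_b not_relR_b, ?_⟩⟩
  cases hi : y i with
  | b j' =>
    obtain ⟨l', hl'⟩ := h.exists_b_eq hi
    simp only [hl', not_relR_b]
  | c β =>
    obtain ⟨α, hα, hαβ⟩ := h.exists_c_eq hi
    rw [hα]
    refine relR_b_c_congr hn hαβ fun hnβ => (hj (β, n) ⟨⟨i, hi⟩, le_min hn hnβ⟩).trans ?_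
    rw [← hα]
    exact ⟨fun ⟨i', hi', hrel⟩ => (h.eq_iff i' i).2 (hi'.trans hi.symm) ▸ hrel,
      fun hrel => ⟨i, hi, hrel⟩⟩

theorem exists_snoc_c {Z : Set Ordinal.{0}} (hZ : IsRich A Z) (h : PartialIso K x y) {α : Idx}
    (hα : min K (depth α) ≠ ⊤) (hαx : ∀ i, x i ≠ .c α) :
    ∃ β : Idx, (β : Ordinal) ∈ Z ∧ PartialIso K (Fin.snoc x (.c α) : Fin (m + 1) → N₂ A)
      (Fin.snoc y (.c β) : Fin (m + 1) → N₂ A) := by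
  obtain ⟨k, hk⟩ := ENat.ne_top_iff_exists.1 hα
  have hb : {j : ℕ | ∃ i, y i = .b j}.Finite :=
    (Set.finite_range y).preimage (f := N₂.b) fun _ _ _ _ h => N₂.b.inj h
  have hc : {β : Idx | ∃ i, y i = .c β}.Finite :=
    (Set.finite_range y).preimage (f := N₂.c) fun _ _ _ _ h => N₂.c.inj h
  obtain ⟨β, ⟨hβZ, hβk, hβ⟩, hβy⟩ := ((hZ k _ ((Set.finite_Iic k).prod hb)
    fun d => ∃ i, y i = .b d.2 ∧ N₂.relR d.1 (x i) (.c α)).sdiff (hc.insert topIdx)).nonempty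
  rw [Set.mem_insert_iff, not_or] at hβy
  have hdepth : min K (depth α) = min K (depth β) := by
    rw [depth_eq hβy.1 hβk, hk, ← min_assoc, min_self]
  refine ⟨β, hβZ, h.snoc (congrArg some hdepth) hαx (fun i hi => hβy.2 ⟨i, hi⟩) fun n hn i =>
    ⟨?_, iff_of_false not_relR_c not_relR_c⟩⟩
  cases hi : y i with
  | c β' =>
    obtain ⟨α', hα', -⟩ := h.exists_c_eq hi
    simp only [hα', not_relR_c]
  | b j =>
    obtain ⟨l, hl⟩ := h.exists_b_eq hi
    rw [hl]
    refine relR_b_c_congr hn hdepth fun hnβ => (hβ (n, j) ⟨?_, i, hi⟩).trans ?_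
    · rw [depth_eq hβy.1 hβk] at hnβ
      exact Nat.cast_le.1 hnβ
    rw [← hl]
    exact ⟨fun ⟨i', hi', hrel⟩ => (h.eq_iff i' i).2 (hi'.trans hi.symm) ▸ hrel,
      fun hrel => ⟨i, hi, hrel⟩⟩

theorem forth (hA : IsIndependent fun t : Idx × ℕ => A t.1 t.2) {Z Z' : Set Ordinal.{0}}
    (hZ : HasFiniteDepth K Z) (hZ' : HasFiniteDepth K Z') (hR : IsRich A Z')
    (hy : ∀ i, y i ∈ restr A Z') (h : PartialIso K x y) {a : N₂ A} (ha : a ∈ restr A Z) :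
    ∃ b ∈ restr A Z', PartialIso K (Fin.snoc x a : Fin (m + 1) → N₂ A)
      (Fin.snoc y b : Fin (m + 1) → N₂ A) := by
  by_cases hax : ∃ i, x i = a
  · obtain ⟨i, rfl⟩ := hax
    refine ⟨y i, hy i, ?_⟩
    have := h.comp (Fin.snoc id i : Fin (m + 1) → Fin m)
    rwa [Fin.comp_snoc, Fin.comp_snoc] at this
  push Not at hax
  cases a with
  | b l =>
    obtain ⟨j, hj⟩ := h.exists_snoc_b hA hZ' hy hax
    exact ⟨_, b_mem_restr, hj⟩
  | c α =>
    obtain ⟨β, hβ, hαβ⟩ := h.exists_snoc_c hR (hZ α (c_mem_restr.1 ha)) hax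
    exact ⟨_, c_mem_restr.2 hβ, hαβ⟩

end PartialIso

end PartialIso

section Preservation

theorem exists_eq_var {γ : Type*} (t : tau.Term γ) : ∃ i, t = .var i := by
  cases t with
  | var i => exact ⟨i, rfl⟩
  | func F => exact Empty.elim F

/-- The index `n` of the symbol `Rₙ`; the unary symbols, present at every level, get `0`. -/
def TauRel.level : {l : ℕ} → TauRel l → ℕ
  | _, .P => 0
  | _, .Q => 0
  | _, .R n => n

theorem exists_eq_c_iff {K : ℕ∞} {a : N₂ A} : (∃ α, a = .c α) ↔ colour K a ≠ none := by
  cases a <;> simp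

theorem exists_eq_b_iff {K : ℕ∞} {a : N₂ A} : (∃ i, a = .b i) ↔ colour K a = none := by
  cases a <;> simp

theorem PartialIso.relMap_iff {K : ℕ∞} {ι : Type*} {x y : ι → N₂ A} (h : PartialIso K x y)
    {l : ℕ} (R : tau.Relations l) (hR : (TauRel.level R : ℕ∞) ≤ K) (f : Fin l → ι) :
    FirstOrder.Language.Structure.RelMap R (x ∘ f) ↔
      FirstOrder.Language.Structure.RelMap R (y ∘ f) := by
  cases R with
  | P =>
    change (∃ α, x (f 0) = .c α) ↔ ∃ α, y (f 0) = .c α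
    rw [exists_eq_c_iff (K := K), exists_eq_c_iff (K := K), h.colour_eq]
  | Q =>
    change (∃ i, x (f 0) = .b i) ↔ ∃ i, y (f 0) = .b i
    rw [exists_eq_b_iff (K := K), exists_eq_b_iff (K := K), h.colour_eq]
  | R n => exact h.rel_iff n hR _ _

theorem backAndForth_restr (hA : IsIndependent fun t : Idx × ℕ => A t.1 t.2) {K : ℕ∞}
    {Z Z' : Set Ordinal.{0}} (hZ : HasFiniteDepth K Z) (hZ' : HasFiniteDepth K Z')
    (hR : IsRich A Z) (hR' : IsRich A Z') :
    Infinitary.BackAndForth (L := tau) (M := restr A Z) (N := restr A Z')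
      {R | (TauRel.level R.2 : ℕ∞) ≤ K}
      fun _ x y => PartialIso K (Subtype.val ∘ x) (Subtype.val ∘ y) where
  realize_eq_iff h s t := by
    obtain ⟨i, rfl⟩ := exists_eq_var s
    obtain ⟨j, rfl⟩ := exists_eq_var t
    simpa only [FirstOrder.Language.Term.realize_var, Function.comp_apply, Subtype.ext_iff]
      using h.eq_iff i j
  relMap_iff h _ R hRK ts := by
    choose f hf using fun i => exists_eq_var (ts i)
    simp only [hf, FirstOrder.Language.Term.realize_var]
    exact h.relMap_iff R hRK f
  forth {_ x y} h a := by
    obtain ⟨b, hb, hab⟩ := h.forth hA hZ hZ' hR' (fun i => (y i).2) a.2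
    refine ⟨⟨b, hb⟩, ?_⟩
    rwa [Fin.comp_snoc, Fin.comp_snoc]
  back {_ x y} h b := by
    obtain ⟨a, ha, hab⟩ := h.symm.forth hA hZ' hZ hR (fun i => (x i).2) b.2
    refine ⟨⟨a, ha⟩, ?_⟩
    rw [Fin.comp_snoc, Fin.comp_snoc]
    exact hab.symm

theorem elemSub_restr (hA : IsIndependent fun t : Idx × ℕ => A t.1 t.2) {Z Z' : Set Ordinal.{0}}
    (hR : IsRich A Z) (h : Z ⊆ Z') : Infinitary.ElemSub (restr A Z) (restr A Z') := by
  refine .of_backAndForth (restr_mono h) fun Λ hΛ => ?_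
  obtain ⟨K, hK⟩ := (hΛ.image fun R => TauRel.level R.2).bddAbove
  refine ⟨_, (backAndForth_restr hA (hasFiniteDepth_natCast K Z') (hasFiniteDepth_natCast K Z)
    (hR.mono h) hR).mono fun R hRΛ => ?_, fun _ => .refl _ _⟩
  exact Nat.cast_le (α := ℕ∞).2 (hK ⟨R, hRΛ, rfl⟩)

theorem infElemSub_restr (hA : IsIndependent fun t : Idx × ℕ => A t.1 t.2)
    {Z Z' : Set Ordinal.{0}} (hR : IsRich A Z) (h : Z ⊆ Z') (hZ' : Z' ⊆ Set.Iio cont) :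
    Infinitary.InfElemSub.{0, 0, w} (restr A Z) (restr A Z') :=
  .of_backAndForth (restr_mono h)
    ((backAndForth_restr hA (hasFiniteDepth_of_subset_Iio ⊤ hZ')
      (hasFiniteDepth_of_subset_Iio ⊤ (h.trans hZ')) (hR.mono h) hR).mono
        fun _ _ => Set.mem_ofPred_eq ▸ le_top) fun _ => .refl _ _

theorem isElementary_restr (hA : IsIndependent fun t : Idx × ℕ => A t.1 t.2)
    {Z : Set Ordinal.{0}} (hR : IsRich A Z) : (restr A Z).IsElementary :=
  Infinitary.ElemSub.isElementary (restr_univ ▸ elemSub_restr hA hR (Set.subset_univ Z))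

end Preservation

section Definability

variable {L : FirstOrder.Language.{u, v}} {M : Type w} [L.Structure M] {B : Set M} {γ : Type*}

theorem definable_iff {p q : (γ → M) → Prop} (hp : B.Definable L {v | p v})
    (hq : B.Definable L {v | q v}) : B.Definable L {v | p v ↔ q v} := by
  convert (hp.inter hq).union (hp.compl.inter hq.compl) using 1
  ext v
  exact iff_iff_and_or_not_and_not

theorem definable_exists [Finite γ] {p : (γ → M) → M → Prop}
    (hp : B.Definable L {v : Option γ → M | p (fun i => v (some i)) (v none)}) :
    B.Definable L {v | ∃ a, p v a} := by
  convert hp.image_comp some using 1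
  ext v
  constructor
  · rintro ⟨a, ha⟩
    exact ⟨fun o => o.elim a v, ha, rfl⟩
  · rintro ⟨v, hv, rfl⟩
    exact ⟨_, hv⟩

theorem definable_forall [Finite γ] {p : (γ → M) → M → Prop}
    (hp : B.Definable L {v : Option γ → M | p (fun i => v (some i)) (v none)}) :
    B.Definable L {v | ∀ a, p v a} := by
  convert (definable_exists (p := fun v a => ¬ p v a) hp.compl).compl using 1
  ext v
  exact not_exists_not.symm

theorem definable₁_of_definable₂ {s : Set (M × M)} (hs : B.Definable₂ L s) {a : M} (ha : a ∈ B) :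
    B.Definable₁ L {x | (a, x) ∈ s} := by
  refine hs.preimage_map (F := fun v : Fin 1 → M => ![a, v 0]) fun i => ?_
  fin_cases i
  exacts [L.definableFun_const _ ha, .proj L]

theorem definable₁_of_finite {G : Set M} (hG : G.Finite) (hGB : G ⊆ B) : B.Definable₁ L G := by
  classical
  lift G to Finset M using hG
  rw [Set.Definable₁]
  convert Set.definable_biUnion_finset
    (fun a : {a // a ∈ B} => Set.Definable.singleton_of_mem L a.2) (G.subtype (· ∈ B)) using 1
  ext v
  simpa using fun h : v 0 ∈ G => hGB h

theorem infinite_inter_of_definable₁ (S : L.ElementarySubstructure M) {D : Set M}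
    (hD : (S : Set M).Definable₁ L D) (hinf : D.Infinite) : (D ∩ S).Infinite := by
  intro hfin
  obtain ⟨x, ⟨hxD, hx⟩, hxS⟩ := S.meetsDefinable (D \ (D ∩ S)) (hinf.sdiff hfin).nonempty
    (hD.sdiff (definable₁_of_finite hfin Set.inter_subset_right))
  exact hx ⟨hxD, hxS⟩

end Definability

section Ordinals

theorem mod_omega0_eq_zero_iff (o : Ordinal.{0}) :
    o % Ordinal.omega0 = 0 ↔ ¬ ∃ a, o = a + 1 := by
  rw [← Ordinal.dvd_iff_mod_eq_zero, ← Ordinal.isSuccPrelimit_iff_omega0_dvd,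
    Order.IsSuccPrelimit, not_exists]
  simp only [← Order.succ_eq_iff_covBy, Order.succ_eq_add_one, eq_comm]

theorem mod_omega0_eq_succ_iff (o : Ordinal.{0}) (k : ℕ) :
    o % Ordinal.omega0 = (k + 1 : ℕ) ↔ ∃ a, o = a + 1 ∧ a % Ordinal.omega0 = k := by
  have hmod (b : Ordinal.{0}) (l : ℕ) : (Ordinal.omega0 * b + l) % Ordinal.omega0 = l := by
    rw [Ordinal.mul_add_mod_self, Ordinal.mod_eq_of_lt (Ordinal.natCast_lt_omega0 l)]
  constructor
  · intro ho
    refine ⟨Ordinal.omega0 * (o / Ordinal.omega0) + k, ?_, hmod _ _⟩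
    rw [add_assoc, ← Nat.cast_succ, ← ho, Ordinal.div_add_mod]
  · rintro ⟨a, rfl, ha⟩
    rw [← Ordinal.div_add_mod a Ordinal.omega0, ha, add_assoc, ← Nat.cast_succ, hmod]

theorem toZFSet_eq_insert_self_iff {o : Ordinal.{0}} {y : ZFSet.{0}} :
    o.toZFSet = insert y y ↔ ∃ a : Ordinal.{0}, o = a + 1 ∧ y = a.toZFSet := by
  constructor
  · intro h
    obtain ⟨a, -, rfl⟩ := Ordinal.mem_toZFSet_iff.1 (h ▸ ZFSet.mem_insert y y)
    exact ⟨a, Ordinal.toZFSet_injective (by rw [h, Ordinal.toZFSet_add_one]), rfl⟩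
  · rintro ⟨a, rfl, rfl⟩
    exact Ordinal.toZFSet_add_one a

end Ordinals

namespace H

variable {κ : Cardinal.{0}}

theorem exists_val_eq_of_mem (x : H κ) {y : ZFSet.{0}} (hy : y ∈ x.val) :
    ∃ y' : H κ, y'.val = y := by
  obtain ⟨t, ht, hxt, hcard⟩ := x.2
  exact ⟨⟨y, t, ht, ht.subset_of_mem (hxt hy), hcard⟩, rfl⟩

theorem exists_val_eq_insert_self {x : H κ} {a : Ordinal.{0}} (hx : x.val = (a + 1).toZFSet) :
    ∃ y : H κ, x.val = insert y.val y.val ∧ y.val = a.toZFSet := by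
  rw [Ordinal.toZFSet_add_one] at hx
  obtain ⟨y, hy⟩ := x.exists_val_eq_of_mem (hx ▸ ZFSet.mem_insert _ _)
  exact ⟨y, by rw [hx, hy], hy⟩

theorem exists_val_eq_pair_of_mem (x : H κ) {a b : ZFSet.{0}} (hx : ZFSet.pair a b ∈ x.val) :
    ∃ p s t a' b' : H κ, p.val = ZFSet.pair a b ∧ s.val = {a} ∧ t.val = {a, b} ∧
      a'.val = a ∧ b'.val = b := by
  obtain ⟨p, hp⟩ := x.exists_val_eq_of_mem hx
  obtain ⟨s, hs⟩ := p.exists_val_eq_of_mem (y := {a}) (by simp [hp, ZFSet.pair])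
  obtain ⟨t, ht⟩ := p.exists_val_eq_of_mem (y := {a, b}) (by simp [hp, ZFSet.pair])
  obtain ⟨a', ha⟩ := t.exists_val_eq_of_mem (y := a) (by simp [ht])
  obtain ⟨b', hb⟩ := t.exists_val_eq_of_mem (y := b) (by simp [ht])
  exact ⟨p, s, t, a', b', hp, hs, ht, ha, hb⟩

section Definable

variable {B : Set (H κ)} {γ : Type*}

theorem definable_mem (i j : γ) :
    B.Definable setLang {v : γ → H κ | (v i).val ∈ (v j).val} := by
  refine Set.Definable.mono (Set.empty_definable_iff.2
    ⟨FirstOrder.Language.Relations.formula₂ (L := setLang) SetRel.mem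
      (FirstOrder.Language.Term.var i) (FirstOrder.Language.Term.var j), ?_⟩) (Set.empty_subset _)
  ext v
  exact (FirstOrder.Language.Formula.realize_rel₂ (L := setLang) (M := H κ) (R := SetRel.mem)
    (t₁ := FirstOrder.Language.Term.var i) (t₂ := FirstOrder.Language.Term.var j)).symm

theorem definable_val_eq_val (i j : γ) :
    B.Definable setLang {v : γ → H κ | (v i).val = (v j).val} := by
  convert Set.DefinableFun.ofPred_eq (A := B) (.proj setLang (i := i)) (.proj setLang (i := j))
    using 1
  ext v
  exact Subtype.ext_iff.symm

variable [Finite γ]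

theorem definable_val_eq {F : (γ → H κ) → ZFSet.{0}} (i : γ)
    (hF : ∀ v, ∀ z ∈ F v, ∃ z' : H κ, z'.val = z)
    (hmem : B.Definable setLang {v : Option γ → H κ | (v none).val ∈ F fun i => v (some i)}) :
    B.Definable setLang {v | (v i).val = F v} := by
  convert definable_forall (p := fun v z => z.val ∈ (v i).val ↔ z.val ∈ F v)
    (definable_iff (definable_mem none (some i)) hmem) using 1
  ext v
  refine ⟨fun h z => by rw [h], fun h => ZFSet.ext fun z => ⟨fun hz => ?_, fun hz => ?_⟩⟩
  · obtain ⟨z, rfl⟩ := (v i).exists_val_eq_of_mem hz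
    exact (h z).1 hz
  · obtain ⟨z, rfl⟩ := hF v z hz
    exact (h z).2 hz

theorem definable_val_eq_insert_self (i j : γ) :
    B.Definable setLang {v : γ → H κ | (v i).val = insert (v j).val (v j).val} := by
  refine definable_val_eq i (fun v z hz => ?_) ?_
  · rcases ZFSet.mem_insert_iff.1 hz with rfl | hz
    exacts [⟨_, rfl⟩, (v j).exists_val_eq_of_mem hz]
  · simp only [ZFSet.mem_insert_iff]
    exact (definable_val_eq_val none (some j)).union (definable_mem none (some j))

theorem definable_val_eq_upair (i j k : γ) :
    B.Definable setLang {v : γ → H κ | (v i).val = {(v j).val, (v k).val}} := by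
  refine definable_val_eq i (fun v z hz => ?_) ?_
  · rcases ZFSet.mem_pair.1 hz with rfl | rfl <;> exact ⟨_, rfl⟩
  · simp only [ZFSet.mem_pair]
    exact (definable_val_eq_val none (some j)).union (definable_val_eq_val none (some k))

theorem definable_pair_mem (i j k : γ) :
    B.Definable setLang {v : γ → H κ | ZFSet.pair (v i).val (v j).val ∈ (v k).val} := by
  convert definable_exists (p := fun v s => ∃ t p : H κ, s.val = {(v i).val, (v i).val} ∧
      t.val = {(v i).val, (v j).val} ∧ p.val = {s.val, t.val} ∧ p.val ∈ (v k).val)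
    (definable_exists <| definable_exists <|
      (definable_val_eq_upair (some (some none)) (some (some (some i)))
        (some (some (some i)))).inter <|
      (definable_val_eq_upair (some none) (some (some (some i))) (some (some (some j)))).inter <|
      (definable_val_eq_upair none (some (some none)) (some none)).inter <|
      definable_mem none (some (some (some k)))) using 1
  ext v
  simp only [Set.mem_ofPred_eq, ZFSet.pair_eq_singleton]
  constructor
  · intro h
    obtain ⟨p, s, t, -, -, hp, hs, ht, -⟩ := (v k).exists_val_eq_pair_of_mem h
    exact ⟨s, t, p, hs, ht, by rw [hp, hs, ht, ZFSet.pair], hp ▸ h⟩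
  · rintro ⟨s, t, p, hs, ht, hp, h⟩
    rwa [hp, hs, ht] at h

theorem definable_pair_pair_mem (i j k l : γ) :
    B.Definable setLang {v : γ → H κ |
      ZFSet.pair (ZFSet.pair (v i).val (v j).val) (v k).val ∈ (v l).val} := by
  convert definable_exists (p := fun v q => ∃ t : H κ, t.val = {q.val} ∧
      ZFSet.pair (v i).val (v j).val ∈ t.val ∧ ZFSet.pair q.val (v k).val ∈ (v l).val)
    (definable_exists <|
      (by simpa only [ZFSet.pair_eq_singleton] using
        definable_val_eq_upair none (some none) (some none) :
        B.Definable setLang {v : Option (Option γ) → H κ | (v none).val = {(v (some none)).val}}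
        ).inter <|
      (definable_pair_mem (some (some i)) (some (some j)) none).inter <|
      definable_pair_mem (some none) (some (some k)) (some (some l))) using 1
  ext v
  constructor
  · intro h
    obtain ⟨-, t, -, q, -, -, ht, -, hq, -⟩ := (v l).exists_val_eq_pair_of_mem h
    exact ⟨q, t, by rw [ht, hq], by simp [ht], by rwa [hq]⟩
  · rintro ⟨q, t, ht, hq, h⟩
    rw [ht, ZFSet.mem_singleton] at hq
    rwa [Set.mem_ofPred_eq, hq]

theorem definable_val_eq_natCast (n : ℕ) (i : γ) :
    B.Definable setLang {v : γ → H κ | (v i).val = (n : Ordinal.{0}).toZFSet} := by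
  induction n generalizing γ with
  | zero =>
    refine definable_val_eq i (fun _ z hz => ?_) ?_
    · simp at hz
    · simp
  | succ n ih =>
    convert definable_exists
      (p := fun (v : γ → H κ) (y : H κ) =>
        (v i).val = insert y.val y.val ∧ y.val = (n : Ordinal.{0}).toZFSet)
      ((definable_val_eq_insert_self (some i) none).inter (ih none)) using 1
    ext v
    rw [Set.mem_ofPred_eq, Set.mem_ofPred_eq, Nat.cast_succ]
    refine ⟨exists_val_eq_insert_self, ?_⟩
    rintro ⟨y, h, hy⟩
    rw [h, hy, Ordinal.toZFSet_add_one]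

end Definable

/-- The set-theoretic rendering of `x = k mod ω`: the ordinal `x` is the `k`-th successor of an
ordinal that is not a successor. -/
def IsModOmega : ℕ → H κ → Prop
  | 0, x => ¬ ∃ y : H κ, x.val = insert y.val y.val
  | k + 1, x => ∃ y : H κ, x.val = insert y.val y.val ∧ IsModOmega k y

theorem definable_isModOmega {B : Set (H κ)} {γ : Type*} [Finite γ] (k : ℕ) (i : γ) :
    B.Definable setLang {v : γ → H κ | IsModOmega k (v i)} := by
  induction k generalizing γ with
  | zero => exact (definable_exists (definable_val_eq_insert_self (some i) none)).compl
  | succ k ih =>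
    exact definable_exists ((definable_val_eq_insert_self (some i) none).inter (ih none))

theorem isModOmega_iff {k : ℕ} {x : H κ} {o : Ordinal.{0}} (hx : x.val = o.toZFSet) :
    IsModOmega k x ↔ o % Ordinal.omega0 = k := by
  induction k generalizing x o with
  | zero =>
    rw [IsModOmega, Nat.cast_zero, mod_omega0_eq_zero_iff, not_iff_not]
    constructor
    · rintro ⟨y, hy⟩
      obtain ⟨a, ha, -⟩ := toZFSet_eq_insert_self_iff.1 (hx ▸ hy)
      exact ⟨a, ha⟩
    · rintro ⟨a, rfl⟩
      obtain ⟨y, hy, -⟩ := exists_val_eq_insert_self hx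
      exact ⟨y, hy⟩
  | succ k ih =>
    rw [IsModOmega, mod_omega0_eq_succ_iff]
    constructor
    · rintro ⟨y, hxy, hk⟩
      obtain ⟨a, ha, hy⟩ := toZFSet_eq_insert_self_iff.1 (hx ▸ hxy)
      exact ⟨a, ha, (ih hy).1 hk⟩
    · rintro ⟨a, rfl, hk⟩
      obtain ⟨y, hxy, hy⟩ := exists_val_eq_insert_self hx
      exact ⟨y, hxy, (ih hy).2 hk⟩

end H

section CodedSequences

variable {κ : Cardinal.{0}} {S x : H κ}

theorem natCast_mem_codeSet {B : Set ℕ} {i : ℕ} :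
    (i : Ordinal.{0}).toZFSet ∈ codeSet B ↔ i ∈ B := by
  simp [codeSet, Ordinal.toZFSet_injective.eq_iff]

theorem pair_pair_mem_codeSeq {x l C : ZFSet.{0}} :
    ZFSet.pair (ZFSet.pair x l) C ∈ codeSeq A ↔ ∃ (α : Idx) (n : ℕ),
      x = (α : Ordinal.{0}).toZFSet ∧ l = (n : Ordinal.{0}).toZFSet ∧ C = codeSet (A α n) := by
  simp [codeSeq, Prod.exists, ZFSet.pair_inj, eq_comm, and_assoc]

/-- The set-theoretic rendering of `i ∈ A α n`, where `S` codes `A` and `x` is the ordinal `α`. -/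
def CodedMem (n i : ℕ) (S x : H κ) : Prop :=
  ∃ l j C : H κ, l.val = (n : Ordinal.{0}).toZFSet ∧ j.val = (i : Ordinal.{0}).toZFSet ∧
    j.val ∈ C.val ∧ ZFSet.pair (ZFSet.pair x.val l.val) C.val ∈ S.val

/-- The set-theoretic rendering of `x` being an index of the sequence coded by `S`. -/
def IsCodedIndex (S x : H κ) : Prop :=
  ∃ l C : H κ, ZFSet.pair (ZFSet.pair x.val l.val) C.val ∈ S.val

theorem exists_coded_term (hS : S.val = codeSeq A) (α : Idx) (n : ℕ) :
    ∃ x l C : H κ, x.val = (α : Ordinal.{0}).toZFSet ∧ l.val = (n : Ordinal.{0}).toZFSet ∧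
      C.val = codeSet (A α n) ∧ ZFSet.pair (ZFSet.pair x.val l.val) C.val ∈ S.val := by
  have hmem := hS ▸ pair_pair_mem_codeSeq.2 ⟨α, n, rfl, rfl, rfl⟩
  obtain ⟨-, -, t, -, C, -, -, ht, -, hC⟩ := S.exists_val_eq_pair_of_mem hmem
  obtain ⟨-, -, -, x, l, -, -, -, hx, hl⟩ :=
    t.exists_val_eq_pair_of_mem (a := (α : Ordinal.{0}).toZFSet) (b := (n : Ordinal.{0}).toZFSet)
      (ht ▸ ZFSet.mem_pair.2 (Or.inl rfl))
  exact ⟨x, l, C, hx, hl, hC, by rwa [hx, hl, hC]⟩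

theorem codedMem_iff (hS : S.val = codeSeq A) {n i : ℕ} {α : Idx}
    (hx : x.val = (α : Ordinal.{0}).toZFSet) : CodedMem n i S x ↔ i ∈ A α n := by
  constructor
  · rintro ⟨l, j, C, hl, hj, hjC, h⟩
    obtain ⟨β, m, hβ, hm, hC⟩ := pair_pair_mem_codeSeq.1 (hS ▸ h)
    obtain rfl : α = β := Subtype.ext (Ordinal.toZFSet_injective (hx.symm.trans hβ))
    obtain rfl : n = m := Nat.cast_injective (Ordinal.toZFSet_injective (hl.symm.trans hm))
    rwa [hj, hC, natCast_mem_codeSet] at hjC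
  · intro hi
    obtain ⟨x', l, C, hx', hl, hC, h⟩ := exists_coded_term hS α n
    obtain ⟨j, hj⟩ := C.exists_val_eq_of_mem (hC ▸ natCast_mem_codeSet.2 hi)
    exact ⟨l, j, C, hl, hj, by rwa [hj, hC, natCast_mem_codeSet], by rwa [hx, ← hx']⟩

theorem isCodedIndex_iff (hS : S.val = codeSeq A) :
    IsCodedIndex S x ↔ ∃ α : Idx, x.val = (α : Ordinal.{0}).toZFSet := by
  constructor
  · rintro ⟨l, C, h⟩
    obtain ⟨α, -, hα, -⟩ := pair_pair_mem_codeSeq.1 (hS ▸ h)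
    exact ⟨α, hα⟩
  · rintro ⟨α, hα⟩
    obtain ⟨x', l, C, hx', -, -, h⟩ := exists_coded_term hS α 0
    exact ⟨l, C, by rwa [hα, ← hx']⟩

variable {B : Set (H κ)} {γ : Type*} [Finite γ]

theorem definable_codedMem (n i : ℕ) (S x : γ) :
    B.Definable setLang {v : γ → H κ | CodedMem n i (v S) (v x)} :=
  definable_exists <| definable_exists <| definable_exists <|
    (H.definable_val_eq_natCast n (some (some none))).inter <|
    (H.definable_val_eq_natCast i (some none)).inter <|
    (H.definable_mem (some none) none).inter <|
    H.definable_pair_pair_mem (some (some (some x))) (some (some none)) none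
      (some (some (some S)))

theorem definable_isCodedIndex (S x : γ) :
    B.Definable setLang {v : γ → H κ | IsCodedIndex (v S) (v x)} :=
  definable_exists <| definable_exists <|
    H.definable_pair_pair_mem (some (some x)) (some none) none (some (some S))

end CodedSequences

section ElementarySubmodels

variable {κ : Cardinal.{0}}

theorem definable_pattern {S : H κ} {B : Set (H κ)} (hSB : S ∈ B) (k : ℕ) {D : Set (ℕ × ℕ)}
    (hD : D.Finite) (p : ℕ × ℕ → Prop) :
    B.Definable₁ setLang {x | IsCodedIndex S x ∧ H.IsModOmega k x ∧
      ∀ d ∈ D, CodedMem d.1 d.2 S x ↔ p d} := by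
  have := hD.to_subtype
  refine definable₁_of_definable₂ (s := {q | IsCodedIndex q.1 q.2 ∧ H.IsModOmega k q.2 ∧
    ∀ d ∈ D, CodedMem d.1 d.2 q.1 q.2 ↔ p d}) ?_ hSB
  have hpattern : B.Definable setLang
      {v : Fin 2 → H κ | ∀ d : D, CodedMem d.1.1 d.1.2 (v 0) (v 1) ↔ p d} := by
    rw [Set.ofPred_forall]
    refine Set.definable_iInter_of_finite fun d => ?_
    by_cases hd : p d
    · simpa only [hd, iff_true] using definable_codedMem d.1.1 d.1.2 0 1
    · simpa only [hd, iff_false] using! (definable_codedMem d.1.1 d.1.2 0 1).compl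
  simpa only [Set.Definable₂, Set.mem_ofPred_eq, Subtype.forall] using!
    (definable_isCodedIndex 0 1).inter ((H.definable_isModOmega k 1).inter hpattern)

theorem isRich_ordinals (X : setLang.ElementarySubstructure (H κ))
    (hAX : ∃ S ∈ X, S.val = codeSeq A) (hR : IsRich A Set.univ) :
    IsRich A {α | ∃ x ∈ X, x.val = α.toZFSet} := by
  obtain ⟨S, hSX, hS⟩ := hAX
  intro k D hD p
  choose code _ _ hcode _ using fun α : Idx => exists_coded_term hS α 0
  have hinj : Function.Injective code := fun α β h =>
    Subtype.ext (Ordinal.toZFSet_injective (by rw [← hcode, h, hcode]))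
  let P : Set Idx := {α | (α : Ordinal) % Ordinal.omega0 = k ∧ ∀ d ∈ D, d.2 ∈ A α d.1 ↔ p d}
  have hP : P.Infinite := by simpa only [Set.mem_univ, true_and] using hR k D hD p
  have himage : code '' P = {x | IsCodedIndex S x ∧ H.IsModOmega k x ∧
      ∀ d ∈ D, CodedMem d.1 d.2 S x ↔ p d} := by
    ext x
    have hx {α : Idx} (hα : x.val = (α : Ordinal.{0}).toZFSet) :
        α ∈ P ↔ H.IsModOmega k x ∧ ∀ d ∈ D, CodedMem d.1 d.2 S x ↔ p d := by
      simp only [P, Set.mem_ofPred_eq, H.isModOmega_iff hα, codedMem_iff hS hα]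
    rw [Set.mem_ofPred_eq, isCodedIndex_iff hS]
    constructor
    · rintro ⟨α, hα, rfl⟩
      exact ⟨⟨α, hcode α⟩, (hx (hcode α)).1 hα⟩
    · rintro ⟨⟨α, hα⟩, h⟩
      exact ⟨α, (hx hα).2 h, Subtype.ext ((hcode α).trans hα.symm)⟩
  have hinf := infinite_inter_of_definable₁ X (himage ▸ definable_pattern hSX k hD p)
    (hP.image hinj.injOn)
  rw [← Set.image_inter_preimage] at hinf
  exact (hinf.of_image _).mono fun α hα => ⟨⟨code α, hα.2, hcode α⟩, hα.1⟩

theorem countable_ordinals {Y : Set (H κ)} (hY : Y.Countable) :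
    {α : Ordinal.{0} | ∃ x ∈ Y, x.val = α.toZFSet}.Countable :=
  (hY.image Subtype.val).preimage Ordinal.toZFSet_injective

theorem countable_restr {Z : Set Ordinal.{0}} (hZ : Z.Countable) : Countable (restr A Z) := by
  refine Set.Countable.to_subtype (s := (restr A Z : Set (N₂ A))) <|
    ((Set.countable_range (N₂.b : ℕ → N₂ A)).union
      ((hZ.preimage Subtype.val_injective).image N₂.c)).mono ?_
  rintro _ (⟨i, rfl⟩ | ⟨α, hα, rfl⟩)
  exacts [Or.inl ⟨i, rfl⟩, Or.inr ⟨α, hα, rfl⟩]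

theorem uncountable_N₁ (A : SetSeq) : Uncountable (N₁ A) := by
  let f (α : Set.Iio cont) : N₁ A := ⟨.c ⟨α, Set.mem_Iic.2 α.2.le⟩, c_mem_restr.2 α.2⟩
  have hf : Function.Injective f := fun α β h => by
    simpa [f, Subtype.ext_iff] using h
  have : Uncountable (Set.Iio cont) := by
    rw [← Cardinal.aleph0_lt_mk_iff, Cardinal.mk_Iio_ordinal]
    simpa [cont] using Cardinal.aleph0_lt_continuum
  exact hf.uncountable

end ElementarySubmodels

end LarsonShelah

theorem proposition1_general {A : LarsonShelah.SetSeq}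
    (hA : LarsonShelah.IsIndependent fun t : LarsonShelah.Idx × ℕ => A t.1 t.2)
    (hR : LarsonShelah.IsRich A Set.univ) {κ : Cardinal.{0}}
    (X : LarsonShelah.setLang.ElementarySubstructure (LarsonShelah.H κ))
    (hAX : ∃ S ∈ X, S.val = LarsonShelah.codeSeq A) (O : Set Ordinal.{0})
    (hO : O = {α | ∃ x ∈ X, x.val = α.toZFSet}) :
    (LarsonShelah.N₁ A).IsElementary ∧
    Infinitary.ElemSub (LarsonShelah.restr A (Set.Iio LarsonShelah.cont ∩ O))
      (LarsonShelah.restr A (Set.Iio (LarsonShelah.cont + 1) ∩ O)) ∧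
    Infinitary.InfElemSub.{0, 0, w} (LarsonShelah.restr A (Set.Iio LarsonShelah.cont ∩ O))
      (LarsonShelah.N₁ A) ∧
    ((X : Set (LarsonShelah.H κ)).Countable → Infinitary.Extendible.{0, 0, w} LarsonShelah.tau
      (LarsonShelah.restr A (Set.Iio LarsonShelah.cont ∩ O))) := by
  have hRO : LarsonShelah.IsRich A (Set.Iio LarsonShelah.cont ∩ O) :=
    hO ▸ (LarsonShelah.isRich_ordinals X hAX hR).Iio_cont_inter
  have hRN₁ : LarsonShelah.IsRich A (Set.Iio LarsonShelah.cont) :=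
    hRO.mono Set.inter_subset_left
  have hInf : Infinitary.InfElemSub.{0, 0, w}
      (LarsonShelah.restr A (Set.Iio LarsonShelah.cont ∩ O)) (LarsonShelah.N₁ A) :=
    LarsonShelah.infElemSub_restr hA hRO Set.inter_subset_left subset_rfl
  refine ⟨LarsonShelah.isElementary_restr hA hRN₁, LarsonShelah.elemSub_restr hA hRO ?_, hInf,
    fun hX => ⟨LarsonShelah.countable_restr ?_, LarsonShelah.N₁ A, inferInstance,
      LarsonShelah.uncountable_N₁ A, hInf.infEquiv⟩⟩
  · exact Set.inter_subset_inter_left O (Set.Iio_subset_Iio (Order.le_succ _))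
  · exact (hO ▸ LarsonShelah.countable_ordinals hX).mono Set.inter_subset_right

theorem proposition1 (A : LarsonShelah.SetSeq) (hA : LarsonShelah.IsGood A)
    (X : LarsonShelah.Submodel)
    (hXcountable : (X : Set (LarsonShelah.H (Order.succ Cardinal.continuum))).Countable)
    (hAX : LarsonShelah.Submodel.Has X (LarsonShelah.codeSeq A)) :
    (LarsonShelah.N₁ A).IsElementary ∧
    Infinitary.ElemSub (LarsonShelah.M₁ A X) (LarsonShelah.M₂ A X) ∧
    Infinitary.InfElemSub.{0, 0, w} (LarsonShelah.M₁ A X) (LarsonShelah.N₁ A) ∧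
    Infinitary.Extendible.{0, 0, w} LarsonShelah.tau (LarsonShelah.M₁ A X) := by
  obtain ⟨h₁, h₂, h₃, h₄⟩ := proposition1_general hA.isIndependent hA.isRich X hAX _ rfl
  exact ⟨h₁, h₂, h₃, h₄ hXcountable⟩
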